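/- Let $\Omega=\{z\in\mathbb{C} : \operatorname{Re} z>0\}$. The Hardy class $H^2_+$ is the set of analytic functions $F:\Omega\to\mathbb{C}$ such that $\sup_{x>0}\int_{\mathbb{R}}|F(x+iy)|^2\,dy<\infty$, with the norm $$\|F\|=\Big(\sup_{x>0}\int_{\mathbb{R}}|F(x+iy)|^2\,dy\Big)^{1/2}.$$ Let $F\in H^2_+$ and suppose that, for some $B>0$, $F(n)=O(e^{-Bn})$ as $n\to+\infty$ along the positive integers. Then $$|F(z)|\le\frac{\|F\|}{\sqrt{4\pi\,\operatorname{Re} z}}\,e^{-B\operatorname{Re} z}\qquad\text{for every } z\in\Omega.$$ -/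

import Mathlib

/-- The open right half-plane. -/
def rightHalfPlane : Set ℂ := {z : ℂ | 0 < z.re}

/-- The squared Hardy norm: the supremum over `x > 0` of the integral over `y ∈ ℝ` of
`|F (x + i y)| ^ 2`, as an extended nonnegative real. -/
noncomputable def hardyNormSq (F : ℂ → ℂ) : ENNReal :=
  ⨆ (x : ℝ) (_ : 0 < x), ∫⁻ y : ℝ, ‖F ((x : ℂ) + Complex.I * (y : ℂ))‖ₑ ^ 2

/-- Membership in the Hardy class of the right half-plane. Only the values of `F` on the open
half-plane matter. -/
structure MemHardy (F : ℂ → ℂ) : Prop where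
  analytic : AnalyticOnNhd ℂ F rightHalfPlane
  normSq_lt_top : hardyNormSq F < ⊤

/-- The Hardy norm, the square root of the (finite, for `F` in the class) supremum. -/
noncomputable def hardyNorm (F : ℂ → ℂ) : ℝ :=
  Real.sqrt (hardyNormSq F).toReal

open Complex MeasureTheory Filter Topology

/-! The function `F s * exp (B * s)` is to satisfy the sharp `H²` point evaluation estimate on each
half-plane `Re s > b`. On the line `Re s = b` the exponential factor has constant modulus `exp (B *
b)`, so the squared norm there is at most `exp (B * b) ^ 2 * ‖F‖ ^ 2`, and `b → 0` gives the claim.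
Working on lines with `b > 0` avoids boundary values on the imaginary axis. The estimate itself
(`norm_sq_le_of_lintegral_line`) is Cauchy's formula for a half-plane followed by Cauchy–Schwarz,
and it needs an a priori polynomial growth bound for the product.

That growth bound is where the decay at the integers enters. `F` is bounded on smaller half-planes
by the mean value property, so `K s = F s / (s + 1) ^ 2` decays quadratically and is the Laplace
transform of a continuous `f` of exponential growth. The decay of `K` at the integers forces `f = 0`
on `(0, B)` by Mikusinski's argument (`eq_zero_of_laplace_nat_decay`). The Laplace integral then
starts at `B`, whence `K z = O(exp (-B * Re z))` on smaller half-planes. -/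

/-! ### Cauchy's theorem and integral formula on a half-plane -/

theorem line_re (a y : ℝ) : ((a : ℂ) + I * (y : ℂ)).re = a := by simp

theorem abs_le_norm_line (a y : ℝ) : |y| ≤ ‖(a : ℂ) + I * (y : ℂ)‖ := by
  simpa using abs_im_le_norm ((a : ℂ) + I * (y : ℂ))

theorem continuous_comp_line {g : ℂ → ℂ} {a : ℝ}
    (hd : ∀ s : ℂ, a ≤ s.re → DifferentiableAt ℂ g s) :
    Continuous fun y : ℝ => g (a + I * y) := by
  refine continuous_iff_continuousAt.2 fun y => ?_
  exact ContinuousAt.comp (f := fun y : ℝ => (a : ℂ) + I * y)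
    (hd _ (line_re a y).ge).continuousAt (by fun_prop)

theorem const_nonneg_of_bound {g : ℂ → ℂ} {a C : ℝ} {k : ℕ}
    (hb : ∀ s : ℂ, a ≤ s.re → ‖g s‖ ≤ C / (1 + ‖s‖) ^ k) : 0 ≤ C := by
  have h := (norm_nonneg _).trans (hb a (by simp))
  by_contra hC
  have : C / (1 + ‖(a : ℂ)‖) ^ k < 0 := div_neg_of_neg_of_pos (not_le.1 hC) (by positivity)
  linarith

theorem div_one_add_norm_sq_le {C r t : ℝ} (hC : 0 ≤ C) (h : |t| ≤ r) :
    C / (1 + r) ^ 2 ≤ C * (1 + t ^ 2)⁻¹ := by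
  rw [div_eq_mul_inv]
  have : t ^ 2 ≤ r ^ 2 := by rw [← sq_abs]; gcongr
  have : 0 ≤ r := (abs_nonneg t).trans h
  gcongr
  nlinarith

theorem integrable_line_of_bound {g : ℂ → ℂ} {a C : ℝ}
    (hd : ∀ s : ℂ, a ≤ s.re → DifferentiableAt ℂ g s)
    (hb : ∀ s : ℂ, a ≤ s.re → ‖g s‖ ≤ C / (1 + ‖s‖) ^ 2) :
    Integrable fun y : ℝ => g (a + I * y) := by
  have hC := const_nonneg_of_bound hb
  refine (integrable_inv_one_add_sq.const_mul C).mono'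
    (continuous_comp_line hd).aestronglyMeasurable (ae_of_all _ fun y => ?_)
  exact (hb _ (line_re a y).ge).trans (div_one_add_norm_sq_le hC (abs_le_norm_line a y))

/-- A function holomorphic on `Re s ≥ a` and decaying quadratically there has integral zero over the
boundary line. -/
theorem integral_line_eq_zero {g : ℂ → ℂ} {a C : ℝ}
    (hd : ∀ s : ℂ, a ≤ s.re → DifferentiableAt ℂ g s)
    (hb : ∀ s : ℂ, a ≤ s.re → ‖g s‖ ≤ C / (1 + ‖s‖) ^ 2) :
    ∫ y : ℝ, g (a + I * y) = 0 := by
  have hC := const_nonneg_of_bound hb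
  have hlim := intervalIntegral_tendsto_integral (l := atTop) (integrable_line_of_bound hd hb)
    tendsto_neg_atTop_atBot tendsto_id
  -- Three sides of a rectangle, each of length at most `2 * R`, on which `‖g‖ ≤ C / R ^ 2`.
  refine tendsto_nhds_unique hlim (squeeze_zero_norm' (a := fun R : ℝ => 6 * C / R) ?_ ?_)
  swap
  · exact tendsto_const_nhds.div_atTop tendsto_id
  filter_upwards [eventually_gt_atTop (|a|), eventually_gt_atTop 0] with R haR hR
  have haR' := abs_lt.1 haR
  have hbd : ∀ s : ℂ, a ≤ s.re → R ≤ ‖s‖ → ‖g s‖ ≤ C / R ^ 2 := fun s hs hRs =>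
    (hb s hs).trans (by gcongr; linarith)
  -- The right edge `a + R + |a|` lies at distance at least `R` from the origin, and the width stays
  -- at most `2 * R`.
  have hrect := integral_boundary_rect_eq_zero_of_differentiableOn g
    ((a : ℂ) + I * (-R : ℝ)) ((a + R + |a| : ℝ) + I * (R : ℝ)) (fun s hs => by
      refine (hd s ?_).differentiableWithinAt
      have := hs.1
      simp only [Set.mem_preimage] at this
      rw [line_re, line_re, Set.uIcc_of_le (by linarith [abs_nonneg a])] at this
      exact this.1)
  have him : ∀ p q : ℝ, ((p : ℂ) + I * (q : ℂ)).im = q := fun p q => by simp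
  simp only [line_re, him, smul_eq_mul] at hrect
  set b := a + R + |a| with hbdef
  have hab : a ≤ b := by linarith [abs_nonneg a]
  have hRb : R ≤ b := by linarith [neg_abs_le a]
  have h1 : ‖∫ x : ℝ in a..b, g (x + (-R : ℝ) * I)‖ ≤ C / R ^ 2 * |b - a| :=
    intervalIntegral.norm_integral_le_of_norm_le_const fun x hx => by
      rw [Set.uIoc_of_le hab] at hx
      refine hbd _ (by simpa using hx.1.le) ?_
      have := abs_im_le_norm ((x : ℂ) + (-R : ℝ) * I)
      simp only [add_im, ofReal_im, mul_im, ofReal_re, I_im, mul_one, I_re, mul_zero, add_zero,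
        zero_add, abs_neg, abs_of_pos hR] at this
      exact this
  have h2 : ‖∫ x : ℝ in a..b, g (x + R * I)‖ ≤ C / R ^ 2 * |b - a| :=
    intervalIntegral.norm_integral_le_of_norm_le_const fun x hx => by
      rw [Set.uIoc_of_le hab] at hx
      refine hbd _ (by simpa using hx.1.le) ?_
      have := abs_im_le_norm ((x : ℂ) + R * I)
      simp only [add_im, ofReal_im, mul_im, ofReal_re, I_im, mul_one, I_re, mul_zero, add_zero,
        zero_add, abs_of_pos hR] at this
      exact this
  have h3 : ‖∫ y : ℝ in (-R)..R, g (b + y * I)‖ ≤ C / R ^ 2 * |R - -R| :=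
    intervalIntegral.norm_integral_le_of_norm_le_const fun y _ => by
      refine hbd _ (by simpa using hab) ?_
      have := re_le_norm ((b : ℂ) + y * I)
      simp only [add_re, ofReal_re, mul_re, I_re, mul_zero, ofReal_im, I_im, mul_one, sub_self,
        add_zero] at this
      linarith
  have hJ : (∫ y : ℝ in (-R)..R, g (a + y * I)) =
      -I * ((∫ x : ℝ in a..b, g (x + (-R : ℝ) * I)) - (∫ x : ℝ in a..b, g (x + R * I))) +
        ∫ y : ℝ in (-R)..R, g (b + y * I) := by
    linear_combination I * hrect + ((∫ y : ℝ in (-R)..R, g (a + y * I)) -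
      ∫ y : ℝ in (-R)..R, g (b + y * I)) * I_mul_I
  have hcomm : (∫ y : ℝ in (-R)..id R, g (a + I * y)) = ∫ y : ℝ in (-R)..R, g (a + y * I) := by
    simp only [mul_comm I, id]
  rw [hcomm, hJ]
  have hba : |b - a| ≤ 2 * R := by rw [abs_of_nonneg (by linarith)]; linarith
  have hRR : |R - -R| = 2 * R := by rw [abs_of_nonneg (by linarith)]; ring
  rw [hRR] at h3
  have hC2 : 0 ≤ C / R ^ 2 := by positivity
  calc _ ≤ ‖∫ x : ℝ in a..b, g (x + (-R : ℝ) * I)‖ + ‖∫ x : ℝ in a..b, g (x + R * I)‖ +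
        ‖∫ y : ℝ in (-R)..R, g (b + y * I)‖ := by
        refine (norm_add_le _ _).trans ?_
        rw [norm_mul, norm_neg, norm_I, one_mul]
        gcongr
        exact norm_sub_le _ _
    _ ≤ C / R ^ 2 * (2 * R) + C / R ^ 2 * (2 * R) + C / R ^ 2 * (2 * R) := by
        gcongr
        · exact h1.trans (by gcongr)
        · exact h2.trans (by gcongr)
    _ = 6 * C / R := by field_simp; ring

theorem one_add_norm_le_of_one_le_norm_sub {s z : ℂ} (h : 1 ≤ ‖s - z‖) :
    1 + ‖s‖ ≤ (2 + ‖z‖) * ‖s - z‖ := by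
  have h1 : ‖s‖ ≤ ‖s - z‖ + ‖z‖ := by simpa using norm_add_le (s - z) z
  nlinarith [norm_nonneg z]

theorem sub_line_ne_zero {a : ℝ} {z : ℂ} (hz : a < z.re) (y : ℝ) : z - (a + I * y) ≠ 0 := by
  intro h
  have := congrArg re h
  rw [sub_re, line_re, zero_re] at this
  linarith

theorem norm_sub_line_sq (a y : ℝ) (z : ℂ) :
    ‖z - (a + I * y)‖ ^ 2 = (z.re - a) ^ 2 + (z.im - y) ^ 2 := by
  rw [Complex.sq_norm, normSq_apply]
  simp
  ring

theorem integrable_inv_sq_add_sub_sq {c : ℝ} (hc : 0 < c) (v : ℝ) :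
    Integrable fun y : ℝ => (c ^ 2 + (v - y) ^ 2)⁻¹ := by
  have h := ((integrable_inv_one_add_sq.comp_div hc.ne').comp_sub_left v).const_mul (c ^ 2)⁻¹
  refine h.congr (ae_of_all _ fun y => ?_)
  simp only
  rw [← mul_inv]
  congr 1
  field_simp

theorem integral_inv_sq_add_sub_sq {c : ℝ} (hc : 0 < c) (v : ℝ) :
    ∫ y : ℝ, (c ^ 2 + (v - y) ^ 2)⁻¹ = Real.pi / c := by
  have h : ∀ y : ℝ, (c ^ 2 + (v - y) ^ 2)⁻¹ = (c ^ 2)⁻¹ * (1 + ((v - y) / c) ^ 2)⁻¹ := by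
    intro y
    rw [← mul_inv]
    congr 1
    field_simp
  simp_rw [h]
  rw [integral_const_mul,
    integral_sub_left_eq_self (fun y => (1 + (y / c) ^ 2)⁻¹) volume v,
    Measure.integral_comp_div (fun y => (1 + y ^ 2)⁻¹), integral_univ_inv_one_add_sq,
    abs_of_pos hc, smul_eq_mul]
  field_simp

/-- Cauchy's integral formula for a half-plane. -/
theorem integral_line_cauchy {h : ℂ → ℂ} {a C : ℝ} {z : ℂ} (hz : a < z.re)
    (hd : ∀ s : ℂ, a ≤ s.re → DifferentiableAt ℂ h s)
    (hb : ∀ s : ℂ, a ≤ s.re → ‖h s‖ ≤ C / (1 + ‖s‖)) :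
    ∫ y : ℝ, h (a + I * y) / (z - (a + I * y)) = 2 * Real.pi * h z := by
  have hC : 0 ≤ C := const_nonneg_of_bound (k := 1) (by simpa using hb)
  set c : ℝ := z.re - a with hc
  have hc0 : 0 < c := by linarith
  -- `-w` is the mirror image of `z` in the line `Re s = a`, so `φ` below has its pole outside the
  -- half-plane, and `φ z = 1`.
  set w : ℂ := (starRingEnd ℂ) z - 2 * a with hw
  have hwre : ∀ s : ℂ, a ≤ s.re → c ≤ (s + w).re := by
    intro s hs
    simp [hw]
    linarith
  have hwc : ∀ s : ℂ, a ≤ s.re → c ≤ ‖s + w‖ := fun s hs => (hwre s hs).trans (re_le_norm _)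
  have hw0 : ∀ s : ℂ, a ≤ s.re → s + w ≠ 0 := fun s hs => norm_pos_iff.1 (hc0.trans_le (hwc s hs))
  set φ : ℂ → ℂ := fun s => 2 * c / (s + w) with hφ
  have hφz : φ z = 1 := by
    have h0 := hw0 z hz.le
    simp only [hφ]
    rw [div_eq_one_iff_eq h0]
    apply Complex.ext <;> simp [hw, hc]
    ring
  have hφd : ∀ s : ℂ, a ≤ s.re → DifferentiableAt ℂ φ s := fun s hs =>
    (differentiableAt_const _).div (by fun_prop) (hw0 s hs)
  obtain ⟨C₁, hC₁⟩ : ∃ C₁, ∀ s : ℂ, a ≤ s.re → ‖φ s‖ ≤ C₁ / (1 + ‖s‖) := by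
    refine ⟨2 * c * (1 + (1 + ‖w‖) / c), fun s hs => ?_⟩
    have h1 := hwc s hs
    have h2 : 0 < ‖s + w‖ := hc0.trans_le h1
    have h3 : ‖s‖ ≤ ‖s + w‖ + ‖w‖ := by simpa using norm_sub_le (s + w) w
    have h4 : 1 + ‖w‖ ≤ (1 + ‖w‖) / c * ‖s + w‖ := by
      rw [div_mul_eq_mul_div, le_div_iff₀ hc0]; gcongr
    have h5 : ‖φ s‖ = 2 * c / ‖s + w‖ := by
      simp [hφ, abs_of_pos hc0]
    rw [h5, div_le_div_iff₀ h2 (by positivity), mul_assoc (2 * c)]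
    have h6 : 1 + ‖s‖ ≤ (1 + (1 + ‖w‖) / c) * ‖s + w‖ := by linarith
    exact mul_le_mul_of_nonneg_left h6 (by positivity)
  -- Subtracting `h z * φ` creates a zero at `z`: `H s / (s - z)` is then holomorphic with quadratic
  -- decay, so its line integral vanishes. What remains is the integral of `φ s / (z - s)`, which is
  -- explicit.
  set H : ℂ → ℂ := fun s => h s - h z * φ s with hH
  have hHz : H z = 0 := by simp [hH, hφz]
  have hHd : ∀ s : ℂ, a ≤ s.re → DifferentiableAt ℂ H s := fun s hs =>
    (hd s hs).sub ((hφd s hs).const_mul _)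
  have hHb : ∀ s : ℂ, a ≤ s.re → ‖H s‖ ≤ (C + ‖h z‖ * C₁) / (1 + ‖s‖) := fun s hs => by
    rw [add_div, mul_div_assoc]
    refine (norm_sub_le _ _).trans ?_
    rw [norm_mul]
    gcongr
    exacts [hb s hs, hC₁ s hs]
  have hC₁0 : 0 ≤ C₁ := const_nonneg_of_bound (k := 1) (by simpa using hC₁)
  set g : ℂ → ℂ := dslope H z with hg
  have hgd : ∀ s : ℂ, a ≤ s.re → DifferentiableAt ℂ g s := by
    intro s hs
    rcases eq_or_ne s z with rfl | hsz
    · have hU : {u : ℂ | a < u.re} ∈ 𝓝 s := (isOpen_lt continuous_const continuous_re).mem_nhds hz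
      have := (differentiableOn_dslope (f := H) hU).2
        (fun u hu => (hHd u (le_of_lt hu)).differentiableWithinAt)
      exact this.differentiableAt hU
    · exact (differentiableAt_dslope_of_ne hsz).2 (hHd s hs)
  have hgs : ∀ s : ℂ, s ≠ z → g s = H s / (s - z) := fun s hs => by
    rw [hg, dslope_of_ne _ hs, slope_def_field, hHz, sub_zero]
  obtain ⟨C₂, hC₂⟩ : ∃ C₂, ∀ s ∈ {u : ℂ | a ≤ u.re} ∩ Metric.closedBall z 1,
      ‖g s‖ ≤ C₂ := by
    have hcomp : IsCompact ({u : ℂ | a ≤ u.re} ∩ Metric.closedBall z 1) :=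
      (isCompact_closedBall z 1).inter_left (isClosed_le continuous_const continuous_re)
    exact hcomp.exists_bound_of_continuousOn
      fun s hs => (hgd s hs.1).continuousAt.continuousWithinAt
  have hC₂0 : 0 ≤ C₂ := (norm_nonneg _).trans (hC₂ z ⟨hz.le, by simp⟩)
  have hgb : ∀ s : ℂ, a ≤ s.re → ‖g s‖ ≤
      ((C + ‖h z‖ * C₁) * (2 + ‖z‖) + C₂ * (2 + ‖z‖) ^ 2) / (1 + ‖s‖) ^ 2 := by
    intro s hs
    rcases le_total ‖s - z‖ 1 with h1 | h1
    · have h2 : ‖s‖ ≤ ‖s - z‖ + ‖z‖ := by simpa using norm_add_le (s - z) z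
      have h3 : 1 + ‖s‖ ≤ 2 + ‖z‖ := by linarith
      rw [le_div_iff₀ (by positivity)]
      calc ‖g s‖ * (1 + ‖s‖) ^ 2 ≤ C₂ * (2 + ‖z‖) ^ 2 := by
            gcongr
            · exact hC₂ s ⟨hs, by simpa [dist_eq_norm] using h1⟩
        _ ≤ _ := le_add_of_nonneg_left (by positivity)
    · have hsz : s ≠ z := by
        rintro rfl
        simp at h1
        linarith
      have h0 : 0 < ‖s - z‖ := by linarith
      rw [hgs s hsz, norm_div, div_le_iff₀ h0, div_mul_eq_mul_div, le_div_iff₀ (by positivity)]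
      have h3 := hHb s hs
      rw [le_div_iff₀ (by positivity)] at h3
      calc ‖H s‖ * (1 + ‖s‖) ^ 2 = (‖H s‖ * (1 + ‖s‖)) * (1 + ‖s‖) := by ring
        _ ≤ (C + ‖h z‖ * C₁) * ((2 + ‖z‖) * ‖s - z‖) := by
            gcongr
            exact one_add_norm_le_of_one_le_norm_sub h1
        _ ≤ _ := by
            rw [← mul_assoc]
            gcongr
            exact le_add_of_nonneg_right (by positivity)
  have hzero := integral_line_eq_zero hgd hgb
  have hint : Integrable fun y : ℝ => -g (a + I * y) := (integrable_line_of_bound hgd hgb).neg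
  -- On the line, `s + w` is the conjugate of `z - s`, so the quotient is a multiple of the Poisson
  -- kernel.
  have hline : ∀ y : ℝ, φ (a + I * y) / (z - (a + I * y)) =
      ((2 * c * (c ^ 2 + (z.im - y) ^ 2)⁻¹ : ℝ) : ℂ) := by
    intro y
    have h1 : (a + I * y : ℂ) + w = (starRingEnd ℂ) (z - (a + I * y)) := by
      simp [hw]
      ring
    have h2 : ((c ^ 2 + (z.im - y) ^ 2 : ℝ) : ℂ) =
        (z - (a + I * y)) * (starRingEnd ℂ) (z - (a + I * y)) := by
      rw [mul_conj, ← norm_sub_line_sq, Complex.sq_norm]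
    simp only [hφ]
    rw [ofReal_mul, ofReal_inv, h2, h1]
    push_cast
    rw [div_div, div_eq_mul_inv, mul_comm (z - _)]
  have hsplit : ∀ y : ℝ, h (a + I * y) / (z - (a + I * y)) =
      -g (a + I * y) + h z * ((2 * c * (c ^ 2 + (z.im - y) ^ 2)⁻¹ : ℝ) : ℂ) := by
    intro y
    have h0 := sub_line_ne_zero hz y
    rw [← hline y, hgs _ (fun h' => h0 (by rw [h', sub_self])), ← neg_sub z, hH]
    field_simp
    ring
  simp_rw [hsplit]
  have hint' : Integrable fun y : ℝ => h z * ((2 * c * (c ^ 2 + (z.im - y) ^ 2)⁻¹ : ℝ) : ℂ) :=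
    (((integrable_inv_sq_add_sub_sq hc0 z.im).const_mul (2 * c)).ofReal).const_mul _
  rw [integral_add hint hint', integral_neg, hzero, integral_const_mul, integral_complex_ofReal, integral_const_mul,
    integral_inv_sq_add_sub_sq hc0]
  push_cast
  have : (c : ℂ) ≠ 0 := by exact_mod_cast hc0.ne'
  field_simp
  ring

/-! ### Point evaluation with the sharp constant -/

/-- Cauchy–Schwarz in Cauchy's formula: the kernel `1 / (z - s)` has squared `L²` norm `π / (z.re -
a)` on the line, and dividing by `(2π)²` gives the constant. -/
theorem norm_sq_le_of_lintegral_line_of_decay {h : ℂ → ℂ} {a C J : ℝ} {z : ℂ} (hz : a < z.re)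
    (hd : ∀ s : ℂ, a ≤ s.re → DifferentiableAt ℂ h s)
    (hb : ∀ s : ℂ, a ≤ s.re → ‖h s‖ ≤ C / (1 + ‖s‖)) (hJ0 : 0 ≤ J)
    (hJ : ∫⁻ y : ℝ, ‖h (a + I * y)‖ₑ ^ 2 ≤ ENNReal.ofReal J) :
    ‖h z‖ ^ 2 ≤ J / (4 * Real.pi * (z.re - a)) := by
  have hc0 : 0 < z.re - a := by linarith
  have hcont : Continuous fun y : ℝ => (z - (a + I * y))⁻¹ :=
    Continuous.inv₀ (by fun_prop) (sub_line_ne_zero hz)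
  have hcs := ENNReal.lintegral_mul_le_Lp_mul_Lq (volume : Measure ℝ)
    (Real.HolderConjugate.two_two) (f := fun y : ℝ => ‖h (a + I * y)‖ₑ)
    (g := fun y : ℝ => ‖(z - (a + I * y))⁻¹‖ₑ)
    (continuous_comp_line hd).enorm.aemeasurable hcont.enorm.aemeasurable
  have hker : ∫⁻ y : ℝ, ‖(z - (a + I * y))⁻¹‖ₑ ^ (2 : ℝ) =
      ENNReal.ofReal (Real.pi / (z.re - a)) := by
    rw [← integral_inv_sq_add_sub_sq hc0 z.im, ofReal_integral_eq_lintegral_ofReal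
      (integrable_inv_sq_add_sub_sq hc0 z.im) (ae_of_all _ fun y => by positivity)]
    congr 1 with y
    rw [← norm_sub_line_sq, ← ofReal_norm, ENNReal.ofReal_rpow_of_nonneg (norm_nonneg _) zero_le_two]
    simp
  have hJ' : ∫⁻ y : ℝ, ‖h (a + I * y)‖ₑ ^ (2 : ℝ) ≤ ENNReal.ofReal J := by
    simpa using hJ
  have h1 : ‖2 * Real.pi * h z‖ₑ ≤
      ENNReal.ofReal (J ^ (1 / 2 : ℝ) * (Real.pi / (z.re - a)) ^ (1 / 2 : ℝ)) := by
    rw [← integral_line_cauchy hz hd hb]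
    refine (enorm_integral_le_lintegral_enorm _).trans ?_
    calc _ = ∫⁻ y : ℝ, ((fun y : ℝ => ‖h (a + I * y)‖ₑ) *
            fun y : ℝ => ‖(z - (a + I * y))⁻¹‖ₑ) y := by
          congr 1 with y
          rw [div_eq_mul_inv, enorm_mul, Pi.mul_apply]
      _ ≤ _ := hcs
      _ ≤ ENNReal.ofReal J ^ (1 / 2 : ℝ) *
            ENNReal.ofReal (Real.pi / (z.re - a)) ^ (1 / 2 : ℝ) := by
          rw [hker]
          gcongr
      _ = _ := by
          rw [ENNReal.ofReal_rpow_of_nonneg hJ0 (by norm_num),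
            ENNReal.ofReal_rpow_of_nonneg (by positivity) (by norm_num),
            ENNReal.ofReal_mul (by positivity)]
  rw [← ofReal_norm, ENNReal.ofReal_le_ofReal_iff (by positivity),
    ← Real.mul_rpow hJ0 (by positivity), ← Real.sqrt_eq_rpow] at h1
  have h3 : ‖2 * Real.pi * h z‖ ^ 2 ≤ J * (Real.pi / (z.re - a)) :=
    (Real.le_sqrt (norm_nonneg _) (by positivity)).1 h1
  rw [norm_mul, norm_mul, norm_real, Real.norm_of_nonneg Real.pi_pos.le] at h3
  rw [le_div_iff₀ (by positivity)]
  rw [← mul_div_assoc, le_div_iff₀ hc0] at h3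
  simp only [Complex.norm_ofNat] at h3
  nlinarith [Real.pi_pos]

/-- The sharp point evaluation bound for `H²` functions of a half-plane of polynomial growth. -/
theorem norm_sq_le_of_lintegral_line {h : ℂ → ℂ} {a C J : ℝ} {z : ℂ} (hz : a < z.re)
    (hd : ∀ s : ℂ, a ≤ s.re → DifferentiableAt ℂ h s)
    (hb : ∀ s : ℂ, a ≤ s.re → ‖h s‖ ≤ C * (1 + ‖s‖) ^ 2) (hJ0 : 0 ≤ J)
    (hJ : ∫⁻ y : ℝ, ‖h (a + I * y)‖ₑ ^ 2 ≤ ENNReal.ofReal J) :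
    ‖h z‖ ^ 2 ≤ J / (4 * Real.pi * (z.re - a)) := by
  have hC : 0 ≤ C := by
    have := (norm_nonneg _).trans (hb a (by simp))
    exact nonneg_of_mul_nonneg_left this (by positivity)
  -- The divisor `(1 + ε * (s - a)) ^ 3` has modulus at least 1 on the half-plane, so it does not
  -- increase the line integral. Being cubic, it turns quadratic growth into decay of order one, and
  -- it tends to 1 as `ε → 0`.
  have hlim : Tendsto (fun ε : ℝ => ‖h z / (1 + ε * (z - a)) ^ 3‖ ^ 2) (𝓝[>] 0)
      (𝓝 (‖h z‖ ^ 2)) := by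
    have : ContinuousAt (fun ε : ℝ => ‖h z / (1 + ε * (z - a)) ^ 3‖ ^ 2) 0 := by
      have h0 : (1 + ((0 : ℝ) : ℂ) * (z - a)) ^ 3 ≠ 0 := by simp
      have h1 : ContinuousAt (fun ε : ℝ => (1 + (ε : ℂ) * (z - a)) ^ 3) 0 := by fun_prop
      exact ((continuousAt_const.div h1 h0).norm).pow 2
    have := this.tendsto.mono_left (nhdsWithin_le_nhds (s := Set.Ioi 0))
    simpa using this
  refine le_of_tendsto hlim (eventually_mem_nhdsWithin.mono fun ε hε => ?_)
  have hε : 0 < ε := hε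
  have hre : ∀ s : ℂ, a ≤ s.re → 1 ≤ ‖1 + ε * (s - a)‖ := fun s hs => by
    refine le_trans ?_ (re_le_norm _)
    have : 0 ≤ ε * (s.re - a) := mul_nonneg hε.le (by linarith)
    simpa using this
  have hne : ∀ s : ℂ, a ≤ s.re → (1 + ε * (s - a)) ^ 3 ≠ 0 := fun s hs =>
    pow_ne_zero _ (norm_pos_iff.1 (by linarith [hre s hs]))
  set D : ℝ := 1 + |a| + 2 / ε with hD
  have hDs : ∀ s : ℂ, a ≤ s.re → 1 + ‖s‖ ≤ D * ‖1 + ε * (s - a)‖ := fun s hs => by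
    have h1 := hre s hs
    have h2 : ‖s‖ ≤ ‖s - a‖ + |a| := by simpa using norm_add_le (s - a) a
    have h3 : ε * ‖s - a‖ ≤ 2 * ‖1 + ε * (s - a)‖ := by
      have := norm_sub_le (1 + ε * (s - a)) 1
      rw [add_sub_cancel_left, norm_mul, norm_real, Real.norm_of_nonneg hε.le, norm_one] at this
      linarith
    have h4 : ‖s - a‖ ≤ 2 / ε * ‖1 + ε * (s - a)‖ := by
      rw [div_mul_eq_mul_div, le_div_iff₀ hε]
      linarith
    have h5 : 1 + |a| ≤ (1 + |a|) * ‖1 + ε * (s - a)‖ := le_mul_of_one_le_right (by positivity) h1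
    rw [hD, add_mul]
    linarith
  refine norm_sq_le_of_lintegral_line_of_decay (h := fun s => h s / (1 + ε * (s - a)) ^ 3)
    (C := C * D ^ 3) hz (fun s hs => (hd s hs).div (by fun_prop) (hne s hs)) (fun s hs => ?_) hJ0
    (le_trans (lintegral_mono fun y => ?_) hJ)
  · have h0 : 0 < ‖1 + ε * (s - a)‖ := by linarith [hre s hs]
    rw [norm_div, norm_pow, div_le_div_iff₀ (by positivity) (by positivity)]
    calc ‖h s‖ * (1 + ‖s‖) ≤ C * (1 + ‖s‖) ^ 2 * (1 + ‖s‖) := by gcongr; exact hb s hs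
      _ = C * (1 + ‖s‖) ^ 3 := by ring
      _ ≤ C * (D * ‖1 + ε * (s - a)‖) ^ 3 := by gcongr; exact hDs s hs
      _ = _ := by ring
  · have h1 := hre (a + I * y) (line_re a y).ge
    simp only
    gcongr 1
    rw [enorm_le_iff_norm_le, norm_div, norm_pow]
    exact div_le_self (norm_nonneg _) (one_le_pow₀ h1)

/-! ### Boundedness of Hardy functions on smaller half-planes -/

/-- The mean value property of the holomorphic function `f ^ 2`. Angles run over `(-π, π)` to match
polar coordinates. -/
theorem enorm_sq_mul_two_pi_le_lintegral_circle {f : ℂ → ℂ} {z : ℂ} {r R : ℝ} (hr : 0 < r)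
    (hrR : r < R) (hf : DifferentiableOn ℂ f (Metric.ball z R)) :
    ENNReal.ofReal (2 * Real.pi) * ‖f z‖ₑ ^ 2 ≤
      ∫⁻ θ in Set.Ioo (-Real.pi) Real.pi,
        ‖f (z + r * (Real.cos θ + Real.sin θ * I))‖ₑ ^ 2 := by
  have hsub : Metric.closedBall z |r| ⊆ Metric.ball z R := by
    rw [abs_of_pos hr]
    exact Metric.closedBall_subset_ball hrR
  have hd : DiffContOnCl ℂ (fun w => f w ^ 2) (Metric.ball z |r|) :=
    DifferentiableOn.diffContOnCl
      ((hf.pow 2).mono (Metric.closure_ball_subset_closedBall.trans hsub))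
  have h := hd.circleAverage
  rw [Real.circleAverage_eq_integral_add (-Real.pi)] at h
  have h' : (2 * Real.pi : ℂ) * f z ^ 2 =
      ∫ θ in (-Real.pi)..Real.pi, f (circleMap z r θ) ^ 2 := by
    rw [← h, intervalIntegral.integral_comp_add_right (fun θ => f (circleMap z r θ) ^ 2)]
    rw [show (0 : ℝ) + -Real.pi = -Real.pi by ring,
      show 2 * Real.pi + -Real.pi = Real.pi by ring, real_smul]
    have : (Real.pi : ℂ) ≠ 0 := by exact_mod_cast Real.pi_ne_zero
    push_cast
    field_simp
  have h2 : ENNReal.ofReal (2 * Real.pi) * ‖f z‖ₑ ^ 2 = ‖(2 * Real.pi : ℂ) * f z ^ 2‖ₑ := by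
    rw [enorm_mul, enorm_pow, ← ofReal_norm (2 * Real.pi : ℂ)]
    congr 2
    simp [abs_of_pos Real.pi_pos]
  rw [h2, h', intervalIntegral.integral_of_le (by linarith [Real.pi_pos]), integral_Ioc_eq_integral_Ioo]
  refine (enorm_integral_le_lintegral_enorm _).trans_eq ?_
  congr 1 with θ
  rw [enorm_pow, circleMap, exp_mul_I]
  push_cast
  rfl

theorem enorm_sq_mul_le_lintegral_ball {f : ℂ → ℂ} {z : ℂ} {R : ℝ} (hR : 0 < R)
    (hf : DifferentiableOn ℂ f (Metric.ball z R)) :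
    ENNReal.ofReal (2 * Real.pi * (R / 2) ^ 2) * ‖f z‖ₑ ^ 2 ≤
      ∫⁻ w in Metric.ball 0 R, ‖f (z + w)‖ₑ ^ 2 := by
  rw [← lintegral_indicator measurableSet_ball, ← Complex.lintegral_comp_polarCoord_symm]
  -- Only the outer annulus is kept: there the polar weight is at least `R / 2`, and the loss in the
  -- constant is harmless.
  set S : Set (ℝ × ℝ) := Set.Ioo (R / 2) R ×ˢ Set.Ioo (-Real.pi) Real.pi with hS
  have hSm : MeasurableSet S := measurableSet_Ioo.prod measurableSet_Ioo
  have hS0 : ∀ p ∈ S, R / 2 < p.1 ∧ p.1 < R := fun p hp => hp.1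
  have hST : S ⊆ polarCoord.target := fun p hp => by
    rw [polarCoord_target]
    exact ⟨Set.mem_Ioi.2 (by linarith [(hS0 p hp).1]), hp.2⟩
  have hball : ∀ p ∈ S, Complex.polarCoord.symm p ∈ Metric.ball (0 : ℂ) R := fun p hp => by
    rw [mem_ball_zero_iff, Complex.norm_polarCoord_symm,
      abs_of_pos (by linarith [(hS0 p hp).1])]
    exact (hS0 p hp).2
  have hmeas : AEMeasurable (fun p : ℝ × ℝ => ENNReal.ofReal p.1 *
      ‖f (z + p.1 * (Real.cos p.2 + Real.sin p.2 * I))‖ₑ ^ 2)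
      ((volume.restrict (Set.Ioo (R / 2) R)).prod
        (volume.restrict (Set.Ioo (-Real.pi) Real.pi))) := by
    rw [Measure.prod_restrict]
    refine AEMeasurable.mul measurable_fst.ennreal_ofReal.aemeasurable (AEMeasurable.pow_const ?_ 2)
    refine (ContinuousOn.aemeasurable ?_ hSm).enorm
    refine hf.continuousOn.comp (by fun_prop) fun p hp => ?_
    have := hball p hp
    rw [Complex.polarCoord_symm_apply, mem_ball_zero_iff] at this
    simpa [dist_eq_norm] using this
  calc ENNReal.ofReal (2 * Real.pi * (R / 2) ^ 2) * ‖f z‖ₑ ^ 2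
      = ∫⁻ _ in Set.Ioo (R / 2) R,
          ENNReal.ofReal (R / 2) * (ENNReal.ofReal (2 * Real.pi) * ‖f z‖ₑ ^ 2) := by
        rw [setLIntegral_const, Real.volume_Ioo, show R - R / 2 = R / 2 by ring,
          ENNReal.ofReal_mul (by positivity), ENNReal.ofReal_pow (by positivity)]
        ring
    _ ≤ ∫⁻ r in Set.Ioo (R / 2) R, ∫⁻ θ in Set.Ioo (-Real.pi) Real.pi, ENNReal.ofReal r *
          ‖f (z + r * (Real.cos θ + Real.sin θ * I))‖ₑ ^ 2 := by
        refine setLIntegral_mono' measurableSet_Ioo fun r hr => ?_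
        rw [lintegral_const_mul' _ _ ENNReal.ofReal_ne_top]
        gcongr
        · exact hr.1.le
        · exact enorm_sq_mul_two_pi_le_lintegral_circle (by linarith [hr.1]) hr.2 hf
    _ = ∫⁻ p in S, ENNReal.ofReal p.1 *
          ‖f (z + p.1 * (Real.cos p.2 + Real.sin p.2 * I))‖ₑ ^ 2 := by
        rw [← lintegral_prod _ hmeas, Measure.prod_restrict]
        rfl
    _ = ∫⁻ p in S, ENNReal.ofReal p.1 • (Metric.ball (0 : ℂ) R).indicator
          (fun w => ‖f (z + w)‖ₑ ^ 2) (Complex.polarCoord.symm p) := by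
        refine setLIntegral_congr_fun hSm fun p hp => ?_
        rw [Set.indicator_of_mem (hball p hp), smul_eq_mul, Complex.polarCoord_symm_apply]
    _ ≤ _ := lintegral_mono_set hST

theorem lintegral_line_le_hardyNormSq (F : ℂ → ℂ) {x : ℝ} (hx : 0 < x) :
    ∫⁻ y : ℝ, ‖F (x + I * y)‖ₑ ^ 2 ≤ hardyNormSq F :=
  le_iSup₂ (f := fun (x : ℝ) (_ : 0 < x) => ∫⁻ y : ℝ, ‖F (x + I * y)‖ₑ ^ 2) x hx

theorem MemHardy.differentiableAt {F : ℂ → ℂ} (hF : MemHardy F) {s : ℂ} (hs : 0 < s.re) :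
    DifferentiableAt ℂ F s :=
  (hF.analytic s hs).differentiableAt

/-- The disc lies in a vertical strip of width `2 * R` inside the half-plane, and each vertical line
of the strip contributes at most `hardyNormSq F`. -/
theorem lintegral_ball_le_hardyNormSq (F : ℂ → ℂ) {z : ℂ} {R : ℝ} (hR : R < z.re) :
    ∫⁻ w in Metric.ball 0 R, ‖F (z + w)‖ₑ ^ 2 ≤ ENNReal.ofReal (2 * R) * hardyNormSq F := by
  rw [← lintegral_indicator measurableSet_ball,
    ← (volume_preserving_equiv_real_prod.symm).lintegral_comp_emb
      measurableEquivRealProd.symm.measurableEmbedding, Measure.volume_eq_prod]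
  -- This half of Tonelli needs no measurability of the integrand.
  refine (lintegral_prod_le _).trans ?_
  calc _ ≤ ∫⁻ x : ℝ, (Set.Ioo (-R) R).indicator (fun _ => hardyNormSq F) x := by
        refine lintegral_mono fun x => ?_
        by_cases hx : x ∈ Set.Ioo (-R) R
        · rw [Set.indicator_of_mem hx]
          refine le_trans ?_ (lintegral_line_le_hardyNormSq F (x := z.re + x) (by linarith [hx.1]))
          rw [← lintegral_add_left_eq_self
            (fun y : ℝ => ‖F ((z.re + x : ℝ) + I * y)‖ₑ ^ 2) z.im]
          refine lintegral_mono fun y => (Set.indicator_le_self _ _ _).trans_eq ?_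
          congr 3
          apply Complex.ext <;> simp [measurableEquivRealProd]
        · rw [Set.indicator_of_notMem hx, le_zero_iff, ← lintegral_zero (μ := (volume : Measure ℝ))]
          congr 1 with y
          refine Set.indicator_of_notMem (fun hy => hx ?_) _
          have h1 := (abs_re_le_norm _).trans_lt (mem_ball_zero_iff.1 hy)
          exact abs_lt.1 h1
    _ = _ := by
        rw [lintegral_indicator measurableSet_Ioo, setLIntegral_const, Real.volume_Ioo, mul_comm,
          show R - -R = 2 * R by ring]

/-- Functions of the Hardy class are bounded on every smaller half-plane. -/
theorem MemHardy.exists_norm_le {F : ℂ → ℂ} (hF : MemHardy F) {a : ℝ} (ha : 0 < a) :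
    ∃ C, ∀ z : ℂ, a ≤ z.re → ‖F z‖ ≤ C := by
  set R := a / 2 with hRdef
  have hR : 0 < R := by positivity
  set K : ENNReal := ENNReal.ofReal (2 * R) * hardyNormSq F /
    ENNReal.ofReal (2 * Real.pi * (R / 2) ^ 2) with hK
  have hpos : 0 < 2 * Real.pi * (R / 2) ^ 2 := by positivity
  have hKtop : K ≠ ⊤ := ENNReal.div_ne_top
    (ENNReal.mul_ne_top ENNReal.ofReal_ne_top hF.normSq_lt_top.ne) (by simpa using hpos)
  refine ⟨Real.sqrt K.toReal, fun z hz => Real.le_sqrt_of_sq_le ?_⟩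
  have hdiff : DifferentiableOn ℂ F (Metric.ball z R) := fun s hs => by
    refine (hF.differentiableAt ?_).differentiableWithinAt
    have h1 := (abs_re_le_norm (s - z)).trans_lt (by simpa [dist_eq_norm] using hs)
    rw [sub_re] at h1
    linarith [(abs_lt.1 h1).1]
  have h := (enorm_sq_mul_le_lintegral_ball hR hdiff).trans
    (lintegral_ball_le_hardyNormSq F (by linarith))
  have h2 : ‖F z‖ₑ ^ 2 ≤ K := by
    rw [hK, ENNReal.le_div_iff_mul_le (Or.inl (by simpa using hpos)) (Or.inl ENNReal.ofReal_ne_top),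
      mul_comm]
    exact h
  have h3 := ENNReal.toReal_mono hKtop h2
  simpa using h3

/-! ### Laplace inversion -/

/-- The inverse Laplace transform, by integration over the line `Re s = a`. -/
noncomputable def inverseLaplace (K : ℂ → ℂ) (a t : ℝ) : ℂ :=
  (2 * Real.pi : ℂ)⁻¹ * (cexp (a * t) * ∫ y : ℝ, K (a + I * y) * cexp (I * y * t))

theorem norm_exp_I_mul_mul (y t : ℝ) : ‖cexp (I * y * t)‖ = 1 := by
  rw [norm_exp]; simp

theorem continuous_inverseLaplace {K : ℂ → ℂ} {a C : ℝ}
    (hd : ∀ s : ℂ, a ≤ s.re → DifferentiableAt ℂ K s)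
    (hb : ∀ s : ℂ, a ≤ s.re → ‖K s‖ ≤ C / (1 + ‖s‖) ^ 2) : Continuous (inverseLaplace K a) := by
  have hK := continuous_comp_line hd
  refine continuous_const.mul (Continuous.mul (by fun_prop) ?_)
  refine continuous_of_dominated (bound := fun y : ℝ => ‖K (a + I * y)‖)
    (fun t => (hK.mul (by fun_prop)).aestronglyMeasurable)
    (fun t => ae_of_all _ fun y => ?_) (integrable_line_of_bound hd hb).norm
    (ae_of_all _ fun y => by fun_prop)
  rw [norm_mul, norm_exp_I_mul_mul, mul_one]

theorem norm_inverseLaplace_le (K : ℂ → ℂ) (a t : ℝ) :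
    ‖inverseLaplace K a t‖ ≤ (2 * Real.pi)⁻¹ * (∫ y : ℝ, ‖K (a + I * y)‖) * Real.exp (a * t) := by
  rw [inverseLaplace, norm_mul, norm_mul, norm_exp]
  have h : ‖∫ y : ℝ, K (a + I * y) * cexp (I * y * t)‖ ≤ ∫ y : ℝ, ‖K (a + I * y)‖ := by
    refine (norm_integral_le_integral_norm _).trans_eq ?_
    congr 1 with y
    rw [norm_mul, norm_exp_I_mul_mul, mul_one]
  have h1 : ‖(2 * Real.pi : ℂ)⁻¹‖ = (2 * Real.pi)⁻¹ := by
    simp [abs_of_pos Real.pi_pos]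
  have h2 : ((a : ℂ) * t).re = a * t := by simp
  rw [h1, h2, mul_assoc, mul_comm (∫ y : ℝ, ‖K (a + I * y)‖)]
  gcongr

/-- Laplace inversion for functions of quadratic decay on a half-plane. -/
theorem integral_inverseLaplace {K : ℂ → ℂ} {a C : ℝ} {z : ℂ} (hz : a < z.re)
    (hd : ∀ s : ℂ, a ≤ s.re → DifferentiableAt ℂ K s)
    (hb : ∀ s : ℂ, a ≤ s.re → ‖K s‖ ≤ C / (1 + ‖s‖) ^ 2) :
    ∫ t in Set.Ioi (0 : ℝ), inverseLaplace K a t * cexp (-z * t) = K z := by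
  have hK := continuous_comp_line hd
  have hC := const_nonneg_of_bound hb
  have hb' : ∀ s : ℂ, a ≤ s.re → ‖K s‖ ≤ C / (1 + ‖s‖) := fun s hs =>
    (hb s hs).trans (by gcongr; exact le_self_pow₀ (by linarith [norm_nonneg s]) two_ne_zero)
  -- Fubini applies because the integrand has modulus `‖K‖ * exp ((a - z.re) * t)` with `a < z.re`;
  -- the `t`-integral then produces the Cauchy kernel.
  have hint : Integrable (Function.uncurry fun t y : ℝ =>
      K (a + I * y) * cexp (-(z - (a + I * y)) * t))
      ((volume.restrict (Set.Ioi 0)).prod volume) := by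
    have h1 : Integrable (fun t : ℝ => Real.exp ((a - z.re) * t)) (volume.restrict (Set.Ioi 0)) :=
      integrableOn_exp_mul_Ioi (by linarith) 0
    refine (h1.mul_prod (integrable_line_of_bound hd hb).norm).mono'
      (Continuous.aestronglyMeasurable ?_) (ae_of_all _ fun p => ?_)
    · have := hK.comp (continuous_snd (X := ℝ))
      simp only [Function.comp_def] at this
      exact this.mul (by fun_prop)
    · rw [Function.uncurry, norm_mul, norm_exp, mul_comm]
      gcongr
      simp
  have hswap := integral_integral_swap hint
  have hinner : ∀ y : ℝ, ∫ t in Set.Ioi (0 : ℝ), K (a + I * y) * cexp (-(z - (a + I * y)) * t) =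
      K (a + I * y) / (z - (a + I * y)) := fun y => by
    rw [integral_const_mul, integral_exp_mul_complex_Ioi (by simp; linarith)]
    simp only [ofReal_zero, mul_zero, Complex.exp_zero]
    rw [neg_div_neg_eq, mul_one_div]
  simp_rw [hinner, integral_line_cauchy hz hd hb'] at hswap
  calc _ = ∫ t in Set.Ioi (0 : ℝ), (2 * Real.pi : ℂ)⁻¹ *
        ∫ y : ℝ, K (a + I * y) * cexp (-(z - (a + I * y)) * t) := by
        congr 1 with t
        rw [inverseLaplace, mul_assoc, mul_right_comm, ← Complex.exp_add, ← integral_const_mul]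
        congr 2 with y
        rw [mul_left_comm, ← Complex.exp_add]
        congr 2
        ring
    _ = _ := by
        rw [integral_const_mul, hswap]
        have : (Real.pi : ℂ) ≠ 0 := by exact_mod_cast Real.pi_ne_zero
        field_simp

theorem integrable_mul_exp_neg {f : ℝ → ℂ} (hf : Continuous f) {M a b : ℝ} (hab : a < b)
    (hfb : ∀ t, 0 < t → ‖f t‖ ≤ M * Real.exp (a * t)) :
    IntegrableOn (fun t : ℝ => f t * cexp (-b * t)) (Set.Ioi 0) ∧
      ∫ t in Set.Ioi (0 : ℝ), ‖f t * cexp (-b * t)‖ ≤ M / (b - a) := by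
  have h1 : IntegrableOn (fun t : ℝ => Real.exp ((a - b) * t)) (Set.Ioi 0) :=
    integrableOn_exp_mul_Ioi (by linarith) 0
  have hle : ∀ t ∈ Set.Ioi (0 : ℝ), ‖f t * cexp (-b * t)‖ ≤ M * Real.exp ((a - b) * t) := by
    intro t ht
    have : Real.exp ((a - b) * t) = Real.exp (a * t) * Real.exp (-b * t) := by
      rw [← Real.exp_add]; ring_nf
    rw [this, ← mul_assoc, norm_mul, norm_exp]
    have h2 : (-(b : ℂ) * t).re = -b * t := by simp
    rw [h2]
    gcongr
    exact hfb t ht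
  have hi : IntegrableOn (fun t : ℝ => f t * cexp (-b * t)) (Set.Ioi 0) :=
    (h1.const_mul M).mono' (Continuous.aestronglyMeasurable (by fun_prop))
      ((ae_restrict_iff' measurableSet_Ioi).2 (ae_of_all _ hle))
  refine ⟨hi, (setIntegral_mono_on hi.norm (h1.const_mul M) measurableSet_Ioi hle).trans_eq ?_⟩
  have h0 : b - a ≠ 0 := by linarith
  have h0' : a - b ≠ 0 := by linarith
  rw [integral_const_mul, integral_exp_mul_Ioi (by linarith)]
  simp only [mul_zero, Real.exp_zero]
  field_simp
  ring

/-! ### Mikusinski's argument: decay at the integers forces vanishing on `(0, B)` -/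

theorem hasSum_one_sub_exp_neg (w : ℝ) :
    HasSum (fun k : ℕ => -(-w) ^ (k + 1) / ((k + 1).factorial : ℝ)) (1 - Real.exp (-w)) := by
  have h := (hasSum_nat_add_iff' 1).2 (NormedSpace.expSeries_div_hasSum_exp (-w))
  rw [← Real.exp_eq_exp_ℝ] at h
  simpa [neg_div] using h.neg

theorem hasSum_exp_sub_one (w : ℝ) :
    HasSum (fun k : ℕ => w ^ (k + 1) / ((k + 1).factorial : ℝ)) (Real.exp w - 1) := by
  have h := (hasSum_nat_add_iff' 1).2 (NormedSpace.expSeries_div_hasSum_exp w)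
  rw [← Real.exp_eq_exp_ℝ] at h
  simpa using h

/-- Mikusinski's smoothed truncation of `f` at `t`, estimated by Laplace transforms at multiples
of `n`. -/
theorem norm_integral_mul_one_sub_exp_le {f : ℝ → ℂ} (hf : Continuous f) {M a B C t : ℝ} {n : ℕ}
    (hn : a < n) (hM : 0 ≤ M)
    (hfb : ∀ t, 0 < t → ‖f t‖ ≤ M * Real.exp (a * t))
    (hL : ∀ m : ℕ, n ≤ m →
      ‖∫ u in Set.Ioi (0 : ℝ), f u * cexp (-(m : ℝ) * u)‖ ≤ C * Real.exp (-B * m)) :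
    ‖∫ u in Set.Ioi (0 : ℝ), f u * ((1 - Real.exp (-Real.exp (n * (t - u))) : ℝ) : ℂ)‖ ≤
      C * (Real.exp (Real.exp (n * (t - B))) - 1) := by
  -- Expanding `1 - exp (-w)` at `w = exp (n * t) * exp (-n * u)` turns the integral into a series
  -- of Laplace transforms of `f` at `(k + 1) * n`. There is no constant term, so every point is at
  -- least `n > a`.
  set c : ℕ → ℝ := fun k => -(-Real.exp (n * t)) ^ (k + 1) / ((k + 1).factorial : ℝ) with hc
  set m : ℕ → ℕ := fun k => (k + 1) * n with hm
  have hnm : ∀ k, n ≤ m k := fun k => Nat.le_mul_of_pos_left n k.succ_pos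
  have hnmR : ∀ k, (n : ℝ) ≤ m k := fun k => by exact_mod_cast hnm k
  have hcabs : ∀ k, |c k| = Real.exp (n * t) ^ (k + 1) / ((k + 1).factorial : ℝ) := fun k => by
    rw [hc]
    simp only [abs_div, abs_neg, abs_pow, Real.abs_exp, Nat.abs_cast]
  set T : ℕ → ℝ → ℂ := fun k u => (c k : ℂ) * (f u * cexp (-(m k : ℝ) * u)) with hT
  have hTs : ∀ u, HasSum (fun k => T k u)
      (f u * ((1 - Real.exp (-Real.exp (n * (t - u))) : ℝ) : ℂ)) := fun u => by
    have h := (Complex.hasSum_ofReal.2 (hasSum_one_sub_exp_neg (Real.exp (n * (t - u))))).mul_left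
      (f u)
    refine h.congr_fun fun k => ?_
    have h1 : Real.exp (n * (t - u)) = Real.exp (n * t) * Real.exp (-n * u) := by
      rw [← Real.exp_add]; ring_nf
    have h2 : cexp (-(m k : ℝ) * u) = ((Real.exp (-n * u) ^ (k + 1) : ℝ) : ℂ) := by
      rw [← Real.exp_nat_mul, ofReal_exp]
      congr 1
      simp only [hm]
      push_cast
      ring
    rw [hT]
    simp only
    rw [h2, h1, hc]
    simp only
    rw [← neg_mul, mul_pow]
    push_cast
    ring
  have hTi : ∀ k, Integrable (T k) (volume.restrict (Set.Ioi 0)) := fun k =>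
    ((integrable_mul_exp_neg hf (hn.trans_le (hnmR k)) hfb).1).const_mul _
  have hTn : Summable fun k => ∫ u in Set.Ioi (0 : ℝ), ‖T k u‖ := by
    refine Summable.of_nonneg_of_le (fun k => integral_nonneg fun u => norm_nonneg _) (fun k => ?_)
      ((hasSum_exp_sub_one (Real.exp (n * t))).summable.mul_right (M / (n - a)))
    simp only [hT]
    simp_rw [norm_mul (c k : ℂ)]
    rw [integral_const_mul, norm_real, Real.norm_eq_abs, hcabs]
    gcongr
    refine (integrable_mul_exp_neg hf (hn.trans_le (hnmR k)) hfb).2.trans ?_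
    have := hnmR k
    have : 0 < n - a := by linarith
    gcongr
  have hsum := hasSum_integral_of_summable_integral_norm hTi hTn
  simp_rw [(hTs _).tsum_eq] at hsum
  have hw := (hasSum_exp_sub_one (Real.exp (n * (t - B)))).mul_left C
  rw [← hsum.tsum_eq, ← hw.tsum_eq]
  refine tsum_of_norm_bounded hw.summable.hasSum fun k => ?_
  simp only [hT]
  rw [integral_const_mul, norm_mul, norm_real, Real.norm_eq_abs, hcabs]
  -- The decay at `m k` replaces `exp (n * t)` by `exp (n * (t - B))` in the exponential series.
  calc _ ≤ Real.exp (n * t) ^ (k + 1) / ((k + 1).factorial : ℝ) * (C * Real.exp (-B * m k)) := by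
        gcongr
        exact hL _ (hnm k)
    _ = _ := by
        have h1 : Real.exp (n * (t - B)) = Real.exp (n * t) * Real.exp (-B * n) := by
          rw [← Real.exp_add]; ring_nf
        have h2 : Real.exp (-B * m k) = Real.exp (-B * n) ^ (k + 1) := by
          rw [← Real.exp_nat_mul]
          simp only [hm]
          push_cast
          ring_nf
        rw [h1, h2, mul_pow]
        ring

/-- From `1 - exp (-w) ≤ min 1 w`. The bound does not depend on `n`, so it serves as the majorant
for dominated convergence. -/
theorem abs_one_sub_exp_neg_exp_le {n N : ℕ} (hnN : N ≤ n) (x : ℝ) :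
    |1 - Real.exp (-Real.exp (n * x))| ≤ Real.exp (N * x) := by
  have h1 : Real.exp (-Real.exp (n * x)) ≤ 1 := Real.exp_le_one_iff.2 (by simp [Real.exp_nonneg])
  have hnN' : (N : ℝ) ≤ n := by exact_mod_cast hnN
  rw [abs_of_nonneg (by linarith)]
  rcases le_total 0 x with hx | hx
  · have : 1 ≤ Real.exp (N * x) := Real.one_le_exp (by positivity)
    linarith [Real.exp_nonneg (-Real.exp (n * x))]
  · have h2 := Real.add_one_le_exp (-Real.exp (n * x))
    have h3 : Real.exp (n * x) ≤ Real.exp (N * x) :=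
      Real.exp_le_exp.2 (mul_le_mul_of_nonpos_right hnN' hx)
    linarith

theorem tendsto_exp_nat_mul_of_neg {x : ℝ} (hx : x < 0) :
    Tendsto (fun n : ℕ => Real.exp (n * x)) atTop (𝓝 0) :=
  Real.tendsto_exp_atBot.comp
    ((tendsto_natCast_atTop_atTop (R := ℝ)).atTop_mul_const_of_neg hx)

/-- The factor tends to 1 for `u < t` and to 0 for `u > t`: a smooth cutoff sharpening to the
indicator of `(0, t)`. -/
theorem tendsto_integral_mul_one_sub_exp {f : ℝ → ℂ} (hf : Continuous f) {M a t : ℝ} {N : ℕ}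
    (hN : a < N) (ht : 0 < t) (hfb : ∀ t, 0 < t → ‖f t‖ ≤ M * Real.exp (a * t)) :
    Tendsto (fun n : ℕ =>
      ∫ u in Set.Ioi (0 : ℝ), f u * ((1 - Real.exp (-Real.exp (n * (t - u))) : ℝ) : ℂ)) atTop
      (𝓝 (∫ u in (0 : ℝ)..t, f u)) := by
  have hset : ∫ u in (0 : ℝ)..t, f u = ∫ u in Set.Ioi (0 : ℝ), (Set.Iio t).indicator f u := by
    rw [intervalIntegral.integral_of_le ht.le, integral_Ioc_eq_integral_Ioo,
      setIntegral_indicator measurableSet_Iio]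
    rfl
  rw [hset]
  have h1 : Integrable (fun u : ℝ => M * Real.exp (N * t) * Real.exp ((a - N) * u))
      (volume.restrict (Set.Ioi 0)) :=
    (integrableOn_exp_mul_Ioi (by linarith) 0).const_mul _
  refine tendsto_integral_filter_of_dominated_convergence _
    (Eventually.of_forall fun n => Continuous.aestronglyMeasurable (by fun_prop)) ?_ h1 ?_
  · filter_upwards [eventually_ge_atTop N] with n hn
    refine (ae_restrict_iff' measurableSet_Ioi).2 (ae_of_all _ fun u hu => ?_)
    rw [norm_mul, norm_real, Real.norm_eq_abs]
    calc _ ≤ M * Real.exp (a * u) * Real.exp (N * (t - u)) := by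
          gcongr
          · exact (norm_nonneg _).trans (hfb u hu)
          · exact hfb u hu
          · exact abs_one_sub_exp_neg_exp_le hn _
      _ = _ := by
          rw [mul_assoc, mul_assoc, ← Real.exp_add, ← Real.exp_add]
          ring_nf
  · have hne : ∀ᵐ u ∂(volume.restrict (Set.Ioi (0 : ℝ))), u ≠ t :=
      ae_restrict_of_ae (Measure.ae_ne volume t)
    filter_upwards [hne] with u hu
    rcases lt_or_gt_of_ne hu with h | h
    · rw [Set.indicator_of_mem (Set.mem_Iio.2 h)]
      have h2 : Tendsto (fun n : ℕ => Real.exp (-Real.exp (n * (t - u)))) atTop (𝓝 0) :=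
        Real.tendsto_exp_neg_atTop_nhds_zero.comp (Real.tendsto_exp_atTop.comp
          ((tendsto_natCast_atTop_atTop (R := ℝ)).atTop_mul_const (by linarith)))
      have h3 := ((h2.const_sub 1).ofReal).const_mul (f u)
      simpa using h3
    · rw [Set.indicator_of_notMem (by simpa using h.le)]
      have h2 := (tendsto_exp_nat_mul_of_neg (x := t - u) (by linarith)).neg
      have h3 : Tendsto (fun n : ℕ => Real.exp (-Real.exp (n * (t - u)))) atTop (𝓝 1) := by
        have := (Real.continuous_exp.tendsto _).comp h2
        simpa [Function.comp_def] using this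
      have h4 := ((h3.const_sub 1).ofReal).const_mul (f u)
      simpa using h4

/-- If the Laplace transform of `f` decays like `exp (-B n)` along the integers, then `f` vanishes
on `(0, B)`. -/
theorem eq_zero_of_laplace_nat_decay {f : ℝ → ℂ} (hf : Continuous f) {M a B C : ℝ} {N : ℕ}
    (hN : a < N) (hM : 0 ≤ M)
    (hfb : ∀ t, 0 < t → ‖f t‖ ≤ M * Real.exp (a * t))
    (hL : ∀ m : ℕ, N ≤ m →
      ‖∫ u in Set.Ioi (0 : ℝ), f u * cexp (-(m : ℝ) * u)‖ ≤ C * Real.exp (-B * m))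
    {t : ℝ} (ht : t ∈ Set.Ioo 0 B) : f t = 0 := by
  -- For `x < B` the series bound `exp (exp (n * (x - B))) - 1` tends to 0, so all primitives vanish
  -- on `(0, B)`; differentiating gives `f = 0`.
  have hzero : ∀ x ∈ Set.Ioo 0 B, ∫ u in (0 : ℝ)..x, f u = 0 := fun x hx => by
    refine tendsto_nhds_unique (tendsto_integral_mul_one_sub_exp hf hN hx.1 hfb)
      (squeeze_zero_norm' (a := fun n : ℕ => C * (Real.exp (Real.exp (n * (x - B))) - 1)) ?_ ?_)
    · filter_upwards [eventually_ge_atTop N] with n hn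
      have hnN : (N : ℝ) ≤ n := by exact_mod_cast hn
      exact norm_integral_mul_one_sub_exp_le hf (hN.trans_le hnN) hM hfb
        fun m hm => hL m (hn.trans hm)
    · have h1 := tendsto_exp_nat_mul_of_neg (x := x - B) (by linarith [hx.2])
      have h2 := (((Real.continuous_exp.tendsto _).comp h1).sub_const 1).const_mul C
      simpa [Function.comp_def] using h2
  have hder := intervalIntegral.integral_hasDerivAt_right (hf.intervalIntegrable 0 t)
    (hf.stronglyMeasurableAtFilter _ _) hf.continuousAt
  have hev : (fun x => ∫ u in (0 : ℝ)..x, f u) =ᶠ[𝓝 t] fun _ => 0 := by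
    filter_upwards [isOpen_Ioo.mem_nhds ht] with x hx using hzero x hx
  exact hder.unique ((hasDerivAt_const t (0 : ℂ)).congr_of_eventuallyEq hev)

/-! ### From decay at the integers to decay on half-planes -/

/-- A function of quadratic decay on a half-plane that decays exponentially along the integers
decays at the same rate throughout the half-plane. -/
theorem exists_norm_le_mul_exp {K : ℂ → ℂ} {a b B C C' : ℝ} {N : ℕ} (hab : a < b)
    (hd : ∀ s : ℂ, a ≤ s.re → DifferentiableAt ℂ K s)
    (hb : ∀ s : ℂ, a ≤ s.re → ‖K s‖ ≤ C / (1 + ‖s‖) ^ 2) (hN : a < N) (hB : 0 < B)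
    (hK : ∀ m : ℕ, N ≤ m → ‖K m‖ ≤ C' * Real.exp (-B * m)) :
    ∃ D, ∀ z : ℂ, b ≤ z.re → ‖K z‖ ≤ D * Real.exp (-B * z.re) := by
  set M := (2 * Real.pi)⁻¹ * (∫ y : ℝ, ‖K (a + I * y)‖) with hM
  have hM0 : 0 ≤ M := mul_nonneg (by positivity) (integral_nonneg fun y => norm_nonneg _)
  have hf := continuous_inverseLaplace hd hb
  have hfb := norm_inverseLaplace_le K a
  rw [← hM] at hfb
  have hvan : ∀ t ∈ Set.Ioo 0 B, inverseLaplace K a t = 0 := fun t ht => by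
    refine eq_zero_of_laplace_nat_decay hf hN hM0 (fun t _ => hfb t) (C := C') (fun m hm => ?_) ht
    have hm' : (N : ℝ) ≤ m := by exact_mod_cast hm
    have := integral_inverseLaplace (z := m) (by simpa using hN.trans_le hm') hd hb
    rw [ofReal_natCast, this]
    exact hK m hm
  refine ⟨M * Real.exp (a * B) / (b - a), fun z hz => ?_⟩
  have haz : a < z.re := hab.trans_le hz
  have hsplit : ∫ t in Set.Ioi (0 : ℝ), inverseLaplace K a t * cexp (-z * t) =
      ∫ t in Set.Ioi B, inverseLaplace K a t * cexp (-z * t) := by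
    rw [← setIntegral_eq_of_subset_of_ae_sdiff_eq_zero measurableSet_Ioi.nullMeasurableSet
      (Set.Ioi_subset_Ioi hB.le)]
    filter_upwards [Measure.ae_ne volume B] with t htB ht
    rw [hvan t ⟨ht.1, lt_of_le_of_ne (not_lt.1 ht.2) htB⟩, zero_mul]
  rw [← integral_inverseLaplace haz hd hb, hsplit]
  have hle : ∀ t, ‖inverseLaplace K a t * cexp (-z * t)‖ ≤ M * Real.exp ((a - z.re) * t) := by
    intro t
    have : Real.exp ((a - z.re) * t) = Real.exp (a * t) * Real.exp (-z.re * t) := by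
      rw [← Real.exp_add]; ring_nf
    rw [this, ← mul_assoc, norm_mul, norm_exp]
    have h2 : (-z * t).re = -z.re * t := by simp
    rw [h2]
    gcongr
    exact hfb t
  refine (norm_integral_le_of_norm_le
    ((integrableOn_exp_mul_Ioi (by linarith) B).const_mul M) (ae_of_all _ hle)).trans ?_
  rw [integral_const_mul, integral_exp_mul_Ioi (by linarith)]
  have h3 : -Real.exp ((a - z.re) * B) / (a - z.re) =
      Real.exp (a * B) * Real.exp (-B * z.re) / (z.re - a) := by
    rw [← Real.exp_add, neg_div, ← div_neg, neg_sub]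
    ring_nf
  have h4 : 0 < b - a := by linarith
  calc _ = M * Real.exp (a * B) / (z.re - a) * Real.exp (-B * z.re) := by rw [h3]; ring
    _ ≤ _ := by gcongr

theorem one_add_norm_le_two_mul {s : ℂ} (hs : 0 ≤ s.re) : 1 + ‖s‖ ≤ 2 * ‖s + 1‖ := by
  have h1 : 1 ≤ ‖s + 1‖ := le_trans (by simpa using hs) (re_le_norm (s + 1))
  have h2 : ‖s‖ ≤ ‖s + 1‖ := by
    rw [← sq_le_sq₀ (norm_nonneg _) (norm_nonneg _), Complex.sq_norm, Complex.sq_norm,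
      normSq_apply, normSq_apply]
    simp
    nlinarith
  linarith

/-- Exponential decay along the integers gives, up to a polynomial factor, exponential decay on
every smaller half-plane. -/
theorem MemHardy.exists_norm_mul_exp_le {F : ℂ → ℂ} (hF : MemHardy F) {a b B : ℝ} (ha : 0 < a)
    (hab : a < b) (hB : 0 < B)
    (hFn : (fun n : ℕ => F (n : ℂ)) =O[atTop] fun n : ℕ => Real.exp (-B * (n : ℝ))) :
    ∃ D, ∀ z : ℂ, b ≤ z.re → ‖F z * cexp (B * z)‖ ≤ D * (1 + ‖z‖) ^ 2 := by
  obtain ⟨C, hC⟩ := hF.exists_norm_le ha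
  obtain ⟨C', hC'⟩ := hFn.bound
  obtain ⟨N₀, hN₀⟩ := eventually_atTop.1 hC'
  -- Past `N` the asymptotic bound holds and the integers lie to the right of the line `Re s = a`.
  set N := max N₀ (⌊a⌋₊ + 1) with hN
  have haN : a < N := by
    refine (Nat.lt_floor_add_one a).trans_le ?_
    exact_mod_cast le_max_right _ _
  have hne : ∀ s : ℂ, 0 ≤ s.re → s + 1 ≠ 0 := fun s hs => by
    have := one_add_norm_le_two_mul hs
    exact norm_pos_iff.1 (by linarith [norm_nonneg s])
  -- Division by `(s + 1) ^ 2` turns boundedness into quadratic decay without spoiling the bound at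
  -- the integers, since `|m + 1| ≥ 1`.
  obtain ⟨D, hD⟩ := exists_norm_le_mul_exp (K := fun s => F s / (s + 1) ^ 2) (C := 4 * C)
    (C' := C') hab
    (fun s hs => by
      have hden : DifferentiableAt ℂ (fun s : ℂ => (s + 1) ^ 2) s := by fun_prop
      exact (hF.differentiableAt (ha.trans_le hs)).div hden
        (pow_ne_zero 2 (hne s (ha.le.trans hs))))
    (fun s hs => by
      have hs0 := ha.le.trans hs
      have h1 := one_add_norm_le_two_mul hs0
      have h2 := norm_pos_iff.2 (hne s hs0)
      have h3 := (norm_nonneg _).trans (hC s hs)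
      rw [norm_div, norm_pow, div_le_div_iff₀ (by positivity) (by positivity)]
      calc ‖F s‖ * (1 + ‖s‖) ^ 2 ≤ C * (2 * ‖s + 1‖) ^ 2 := by
            gcongr
            exact hC s hs
        _ = _ := by ring)
    haN hB
    (fun m hm => by
      have h1 := hN₀ m ((le_max_left _ _).trans hm)
      rw [Real.norm_of_nonneg (Real.exp_nonneg _)] at h1
      refine le_trans ?_ h1
      rw [norm_div, norm_pow]
      refine div_le_self (norm_nonneg _) (one_le_pow₀ ?_)
      exact le_trans (by simp) (re_le_norm ((m : ℂ) + 1)))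
  refine ⟨D, fun z hz => ?_⟩
  have hz0 : 0 ≤ z.re := by linarith
  have h := hD z hz
  have h2 := norm_pos_iff.2 (hne z hz0)
  have hD0 : 0 ≤ D := nonneg_of_mul_nonneg_left ((norm_nonneg _).trans h) (Real.exp_pos _)
  rw [norm_div, norm_pow, div_le_iff₀ (by positivity)] at h
  have h3 : ‖z + 1‖ ≤ 1 + ‖z‖ := by simpa [add_comm] using norm_add_le z 1
  have h4 : Real.exp (-B * z.re) * Real.exp (B * z.re) = 1 := by
    rw [← Real.exp_add]; simp
  rw [norm_mul, norm_exp, re_ofReal_mul]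
  calc ‖F z‖ * Real.exp (B * z.re) ≤
        D * Real.exp (-B * z.re) * ‖z + 1‖ ^ 2 * Real.exp (B * z.re) := by gcongr
    _ = D * ‖z + 1‖ ^ 2 * (Real.exp (-B * z.re) * Real.exp (B * z.re)) := by ring
    _ = D * ‖z + 1‖ ^ 2 := by rw [h4, mul_one]
    _ ≤ _ := by gcongr

/-! ### The sharp bound and the limit `b → 0` -/

theorem MemHardy.norm_sq_mul_exp_le {F : ℂ → ℂ} (hF : MemHardy F) {b B : ℝ} (hb : 0 < b)
    (hB : 0 < B)
    (hFn : (fun n : ℕ => F (n : ℂ)) =O[atTop] fun n : ℕ => Real.exp (-B * (n : ℝ)))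
    {z : ℂ} (hz : b < z.re) :
    (‖F z‖ * Real.exp (B * z.re)) ^ 2 ≤
      Real.exp (B * b) ^ 2 * hardyNorm F ^ 2 / (4 * Real.pi * (z.re - b)) := by
  -- Inverting along `Re s = b / 2` gives growth control up to and including the line `Re s = b`;
  -- the value of `D` does not enter the final bound.
  obtain ⟨D, hD⟩ := hF.exists_norm_mul_exp_le (half_pos hb) (half_lt_self hb) hB hFn
  have h := norm_sq_le_of_lintegral_line (h := fun s => F s * cexp (B * s)) hz
    (fun s hs => (hF.differentiableAt (hb.trans_le hs)).mul (by fun_prop)) hD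
    (J := Real.exp (B * b) ^ 2 * hardyNorm F ^ 2) (by positivity) ?_
  · rwa [norm_mul, norm_exp, re_ofReal_mul] at h
  · have h1 : ∀ y : ℝ, ‖F (b + I * y) * cexp (B * (b + I * y))‖ₑ ^ 2 =
        ENNReal.ofReal (Real.exp (B * b) ^ 2) * ‖F (b + I * y)‖ₑ ^ 2 := fun y => by
      rw [enorm_mul, mul_pow, mul_comm, ENNReal.ofReal_pow (Real.exp_nonneg _),
        ← ofReal_norm (cexp _), norm_exp, re_ofReal_mul, line_re]
    simp_rw [h1]
    rw [lintegral_const_mul' _ _ ENNReal.ofReal_ne_top, ENNReal.ofReal_mul (by positivity),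
      hardyNorm, Real.sq_sqrt ENNReal.toReal_nonneg, ENNReal.ofReal_toReal hF.normSq_lt_top.ne]
    gcongr
    exact lintegral_line_le_hardyNormSq F hb

theorem mainTheorem7 (F : ℂ → ℂ) (hF : MemHardy F) (B : ℝ) (hB : 0 < B)
    (hFn : (fun n : ℕ => F (n : ℂ)) =O[Filter.atTop] fun n : ℕ => Real.exp (-B * (n : ℝ))) :
    ∀ z ∈ rightHalfPlane,
      ‖F z‖ ≤ hardyNorm F / Real.sqrt (4 * Real.pi * z.re) * Real.exp (-B * z.re) := by
  intro z hz
  have hz : 0 < z.re := hz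
  have hlim : Tendsto (fun b : ℝ =>
      Real.exp (B * b) ^ 2 * hardyNorm F ^ 2 / (4 * Real.pi * (z.re - b))) (𝓝[>] 0)
      (𝓝 (hardyNorm F ^ 2 / (4 * Real.pi * z.re))) := by
    have h0 : 4 * Real.pi * (z.re - 0) ≠ 0 := by rw [sub_zero]; positivity
    have h1 : ContinuousAt (fun b : ℝ => Real.exp (B * b) ^ 2 * hardyNorm F ^ 2) 0 := by fun_prop
    have h2 : ContinuousAt (fun b : ℝ => 4 * Real.pi * (z.re - b)) 0 := by fun_prop
    have h3 := (h1.div h2 h0).tendsto.mono_left (nhdsWithin_le_nhds (s := Set.Ioi 0))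
    simpa [Pi.div_def] using h3
  have hsq : (‖F z‖ * Real.exp (B * z.re)) ^ 2 ≤ hardyNorm F ^ 2 / (4 * Real.pi * z.re) := by
    refine ge_of_tendsto hlim ?_
    filter_upwards [Ioo_mem_nhdsGT hz] with b hb
    exact hF.norm_sq_mul_exp_le hb.1 hB hFn hb.2
  have h := Real.le_sqrt_of_sq_le hsq
  have hN : 0 ≤ hardyNorm F := Real.sqrt_nonneg _
  rw [Real.sqrt_div (sq_nonneg _), Real.sqrt_sq hN] at h
  rw [neg_mul, Real.exp_neg, ← div_eq_mul_inv, le_div_iff₀ (Real.exp_pos _)]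
  exact h
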